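/- **Corollary 3.7 (Poincaré lemma).** Let $\mathfrak g$ be a Lie algebra over a field $k$ of characteristic zero with basis $\hat x_1,\dots,\hat x_n$, and let $\hat S(\mathfrak g^*)=k[[\partial^1,\dots,\partial^n]]$ be the completed symmetric algebra of the dual, where $\partial^1,\dots,\partial^n$ is the dual basis. Let $\boldsymbol\phi:\mathfrak g\to\operatorname{Der}_k(\hat S(\mathfrak g^*))$ be a homomorphism of Lie algebras such that the matrix $\phi=(\phi^j_i)$, $\phi^j_i=\boldsymbol\phi(-\hat x_i)(\partial^j)$, is the unit matrix at $\partial=0$. Let $\blacktriangleright$ be the $\boldsymbol\phi$-deformed Fock action of $\hat S(\mathfrak g^*)$ on $U(\mathfrak g)$, that is, the bilinear map determined by $P\blacktriangleright 1=P(0)$ and $P\blacktriangleright(xu)=x\,(P\blacktriangleright u)+\boldsymbol\phi(-x)(P)\blacktriangleright u$ for $x\in\mathfrak g$, $u\in U(\mathfrak g)$, $P\in\hat S(\mathfrak g^*)$, and let $\hat\partial^j=(\partial^j\blacktriangleright):U(\mathfrak g)\to U(\mathfrak g)$ be the deformed derivatives. Let $E=(\Lambda^*(\mathfrak g)\otimes\hat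 S(\mathfrak g^*))\,\sharp\, U(\mathfrak g)$ be the extended algebra of $\boldsymbol\phi$-twisted differential forms, where $\Lambda^*(\mathfrak g)$ is generated by $d\hat x_1,\dots,d\hat x_n$ (as a left $\Lambda^*(\mathfrak g)\otimes\hat S(\mathfrak g^*)$-module it is $(\Lambda^*(\mathfrak g)\otimes\hat S(\mathfrak g^*))\otimes_k U(\mathfrak g)$), graded by the exterior degree, $E=\bigoplus_p E^p$. Let $$\hat d=\sum_{i,j} d\hat x_i\,(\phi^{-1})^i_j\,\hat\partial^j:E\to E,$$ where $\hat\partial^j$ acts on $U(\mathfrak g)$ and commutes with left multiplication by elements of $\Lambda^*(\mathfrak g)\otimes\hat S(\mathfrak g^*)$. Put $dx_j=\sum_i d\hat x_i(\phi^{-1})^i_j$, and let $\Lambda^*_U(\mathfrak g)\subset E$ be the span of the products $\omega u$ with $\omega$ in the algebra generated by $dx_1,\dots,dx_n$ and $u\in U(\mathfrak g)$; let $\Lambda^p_U(\mathfrak g)=\Lambda^*_U(\mathfrak g)\cap E^p$. 1. If $\hat f\in\Lambda^*_U(\mathfrak g)$ and $\hat d\hat f=0$, then $\hat f=c+\hat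 d\hat h$ for some $c\in k$ and $\hat h\in\Lambda^*_U(\mathfrak g)$. In particular, if $\hat f\in\Lambda^0_U(\mathfrak g)$, then $\hat f=c\in k$ is constant, and if $\hat f\in\Lambda^{p+1}_U(\mathfrak g)$ with $p\ge 0$, then $\hat f=\hat d\hat h$ for some $\hat h\in\Lambda^{p}_U(\mathfrak g)$. 2. If $\hat f\in E$ and $\hat d\hat f=0$, then $\hat f=P+\hat d\hat h$ for some $P\in\hat S(\mathfrak g^*)$ and $\hat h\in E$. In particular, if $\hat f\in E^0$, then $\hat f=P\in\hat S(\mathfrak g^*)$, and if $\hat f\in E^{p+1}$ with $p\ge 0$, then $\hat f=\hat d\hat h$ for some $\hat h\in E^{p}$. -/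

import Mathlib

open scoped TensorProduct

noncomputable section

namespace TwistedForms

attribute [local instance 100] LieRing.ofAssociativeRing

variable {k : Type*} [Field k] {g : Type*} [LieRing g] [LieAlgebra k g] {n : ℕ}

/-- The completed symmetric algebra `Ŝ(g*)`, written in a basis of `g`: formal power series in the
dual basis `∂¹, …, ∂ⁿ`, where `∂ʲ` is the variable `MvPowerSeries.X j`. -/
abbrev SHat (k : Type*) [Field k] (n : ℕ) : Type _ := MvPowerSeries (Fin n) k

/-- The matrix `φ = (φʲᵢ)`, `φʲᵢ = 𝛗(-x̂ᵢ)(∂ʲ)`; the upper index `j` is the row. -/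
def phiMatrix (b : Module.Basis (Fin n) k g)
    (φ : g →ₗ⁅k⁆ Derivation k (SHat k n) (SHat k n)) : Matrix (Fin n) (Fin n) (SHat k n) :=
  Matrix.of fun j i => φ (-(b i)) (MvPowerSeries.X j)

/-- `φ` is close to the identity, `φʲᵢ = δʲᵢ + O(∂)`: its value at `∂ = 0` is the unit matrix. -/
def CloseToIdentity (b : Module.Basis (Fin n) k g)
    (φ : g →ₗ⁅k⁆ Derivation k (SHat k n) (SHat k n)) : Prop :=
  (phiMatrix b φ).map (MvPowerSeries.constantCoeff (σ := Fin n) (R := k)) = 1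

/-- The operator `F ↦ (P ↦ x · F(P) + F(𝛗(-x)(P)))` on linear maps `F : Ŝ(g*) → U(g)`. -/
def fockStep (φ : g →ₗ⁅k⁆ Derivation k (SHat k n) (SHat k n)) (x : g) :
    Module.End k (SHat k n →ₗ[k] UniversalEnvelopingAlgebra k g) where
  toFun F := (LinearMap.mulLeft k (UniversalEnvelopingAlgebra.ι k x)) ∘ₗ F +
    F ∘ₗ (φ (-x) : SHat k n →ₗ[k] SHat k n)
  map_add' F G := by
    ext P
    simp [mul_add]
    abel
  map_smul' c F := by
    ext P
    simp

/-- `fockStep` as a Lie algebra homomorphism in `x`. -/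
def fockLie (φ : g →ₗ⁅k⁆ Derivation k (SHat k n) (SHat k n)) :
    g →ₗ⁅k⁆ Module.End k (SHat k n →ₗ[k] UniversalEnvelopingAlgebra k g) where
  toFun := fockStep φ
  map_add' x y := by
    ext F P
    simp [fockStep, add_mul]
    abel
  map_smul' c x := by
    ext F P
    simp [fockStep]
  map_lie' {x y} := by
    ext F P
    simp [fockStep, LieRing.of_associative_ring_bracket, mul_add,
      sub_mul, mul_assoc]
    abel

/-- The `𝛗`-deformed Fock action `P ▸ u` of `Ŝ(g*)` on `U(g)`, as a linear map in `P` for each `u`.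
It is what one gets by moving `P` to the right of `u` in the smash product `U(g) ♯ Ŝ(g*)`, where
`P x = x P + 𝛗(-x)(P)` for `x ∈ g` (so `[∂ʲ, x̂ᵢ] = φʲᵢ`), and then applying it to the vacuum `1`,
on which `P` acts by its constant term:
`P ▸ 1 = P(0)` and `P ▸ (x u) = x (P ▸ u) + 𝛗(-x)(P) ▸ u`. -/
def fock (φ : g →ₗ⁅k⁆ Derivation k (SHat k n) (SHat k n)) :
    UniversalEnvelopingAlgebra k g →ₗ[k] SHat k n →ₗ[k] UniversalEnvelopingAlgebra k g :=
  (LinearMap.applyₗ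
      ((Algebra.linearMap k (UniversalEnvelopingAlgebra k g)) ∘ₗ
        (MvPowerSeries.coeff (R := k) (0 : Fin n →₀ ℕ)))) ∘ₗ
    (UniversalEnvelopingAlgebra.lift k (fockLie φ)).toLinearMap

theorem fock_one (φ : g →ₗ⁅k⁆ Derivation k (SHat k n) (SHat k n)) (P : SHat k n) :
    fock φ 1 P = algebraMap k _ (MvPowerSeries.constantCoeff P) := by
  simp [fock]

theorem fock_mul (φ : g →ₗ⁅k⁆ Derivation k (SHat k n) (SHat k n)) (P : SHat k n) (x : g)
    (u : UniversalEnvelopingAlgebra k g) :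
    fock φ (UniversalEnvelopingAlgebra.ι k x * u) P =
      UniversalEnvelopingAlgebra.ι k x * fock φ u P + fock φ u (φ (-x) P) := by
  simp [fock, fockLie, fockStep]

/-- The deformed derivative `∂̂ʲ = (∂ʲ ▸) : U(g) → U(g)`. In other words `∂̂ʲ = ξ ∘ ∂ʲ ∘ ξ⁻¹` for the
coalgebra isomorphism `ξ : S(g) → U(g)` given by `ξ⁻¹(u) = u^φ |0⟩`, since `ξ⁻¹` intertwines the
deformed Fock action on `U(g)` with the usual one on `S(g)`. -/
def dHatPartial (φ : g →ₗ⁅k⁆ Derivation k (SHat k n) (SHat k n)) (j : Fin n) :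
    UniversalEnvelopingAlgebra k g →ₗ[k] UniversalEnvelopingAlgebra k g :=
  (fock φ).flip (MvPowerSeries.X j)

/-- The algebra `Λ*(g) ⊗ Ŝ(g*)`, with `Λ*(g)` generated by the `dx̂ᵢ`. -/
abbrev FormCoeff (k : Type*) [Field k] (g : Type*) [LieRing g] [LieAlgebra k g] (n : ℕ) : Type _ :=
  ExteriorAlgebra k g ⊗[k] SHat k n

/-- The underlying vector space of the extended algebra of `𝛗`-twisted differential forms
`(Λ*(g) ⊗ Ŝ(g*)) ♯ U(g)`; the pure tensor `ω ⊗ u` is the product `ω u`. Of the smash product only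
left multiplication by elements of `Λ*(g) ⊗ Ŝ(g*)` is needed below, and this is multiplication in
the first tensor factor. -/
abbrev ExtForms (k : Type*) [Field k] (g : Type*) [LieRing g] [LieAlgebra k g] (n : ℕ) : Type _ :=
  FormCoeff k g n ⊗[k] UniversalEnvelopingAlgebra k g

/-- The generator `dx̂ᵢ`. -/
def dxHat (b : Module.Basis (Fin n) k g) (i : Fin n) : FormCoeff k g n :=
  ExteriorAlgebra.ι k (b i) ⊗ₜ[k] (1 : SHat k n)

/-- A power series in the `∂ʲ`, as an element of `Λ*(g) ⊗ Ŝ(g*)`. -/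
def ofSHat (P : SHat k n) : FormCoeff k g n :=
  (1 : ExteriorAlgebra k g) ⊗ₜ[k] P

/-- The twisted exterior derivative `d̂ = ∑ dx̂ₖ (φ⁻¹)ᵏⱼ ∂̂ʲ`. Here `∂̂ʲ` acts on `U(g)` and commutes
with left multiplication by the `dx̂ᵢ` and by `Ŝ(g*)`. -/
def dHat (b : Module.Basis (Fin n) k g) (φ : g →ₗ⁅k⁆ Derivation k (SHat k n) (SHat k n)) :
    ExtForms k g n →ₗ[k] ExtForms k g n :=
  ∑ i : Fin n, ∑ j : Fin n,
    (LinearMap.mulLeft k (dxHat b i * ofSHat ((phiMatrix b φ)⁻¹ i j))).rTensor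
        (UniversalEnvelopingAlgebra k g) ∘ₗ
      (dHatPartial φ j).lTensor (FormCoeff k g n)

/-- The undeformed differentials `dxⱼ = ∑ dx̂ₖ (φ⁻¹)ᵏⱼ`, so that `dx̂ᵢ = ∑ dxⱼ φʲᵢ`. -/
def dx (b : Module.Basis (Fin n) k g) (φ : g →ₗ⁅k⁆ Derivation k (SHat k n) (SHat k n))
    (j : Fin n) : FormCoeff k g n :=
  ∑ i : Fin n, dxHat b i * ofSHat ((phiMatrix b φ)⁻¹ i j)

/-- `Λ*_U(g) = Λ*(g) ⊗ U(g)` inside the extended algebra, with `Λ*(g)` generated by the `dxⱼ`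
(which commute with `U(g)`): the span of the products `ω u` with `ω` in the algebra generated by
the `dxⱼ` and `u ∈ U(g)`. -/
def uForms (b : Module.Basis (Fin n) k g) (φ : g →ₗ⁅k⁆ Derivation k (SHat k n) (SHat k n)) :
    Submodule k (ExtForms k g n) :=
  Submodule.span k
    {f | ∃ ω ∈ Algebra.adjoin k (Set.range (dx b φ)), ∃ u : UniversalEnvelopingAlgebra k g,
      f = ω ⊗ₜ[k] u}

/-- The elements of exterior degree `p` of the extended algebra. -/
def formsOfDegree (k : Type*) [Field k] (g : Type*) [LieRing g] [LieAlgebra k g] (n p : ℕ) :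
    Submodule k (ExtForms k g n) :=
  Submodule.span k
    {f | ∃ ω ∈ ⋀[k]^p g, ∃ P : SHat k n, ∃ u : UniversalEnvelopingAlgebra k g,
      f = (ω ⊗ₜ[k] P) ⊗ₜ[k] u}

/-- `Ŝ(g*)` inside the extended algebra. -/
def constForm (k : Type*) [Field k] (g : Type*) [LieRing g] [LieAlgebra k g] {n : ℕ}
    (P : SHat k n) : ExtForms k g n :=
  (ofSHat P : FormCoeff k g n) ⊗ₜ[k] (1 : UniversalEnvelopingAlgebra k g)

end TwistedForms

end

/-! The derivatives ∂̂ʲ and the coordinates x_i = ∑ x̂_l (φ⁻¹)ˡ_i (`coordOp`) satisfy the canonical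
commutation relations on U(g), which therefore behaves like a polynomial ring. In the frame dx_j the
differential is d̂ = ∑ dx_j ∂̂ʲ. Put h = ∑ ι_j ⊗ x_j (`homotopyOp`), with ι_j the contraction dual
to dx_j. Then d̂h + hd̂ is the exterior degree plus the Euler operator ∑ x_i ∂̂ⁱ (`laplacian_tmul`).
In characteristic zero it is diagonalizable with natural eigenvalues and kernel Ŝ(g*), so a closed
form is its harmonic part plus a boundary (`exists_harmonic_add_boundary`). The harmonic part stays
in any Laplacian-stable subspace containing the form.

The hard point is that the Euler operator is diagonalizable with only scalars in its kernel, which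
needs the x_i to commute. Both facts come from one induction on the standard filtration
(`coordOp_comm_of_mem`): a commutator of coordinates is killed by every ∂̂ʲ, hence is a scalar, and
its counit is zero. Neither PBW nor the isomorphism ξ enters. -/

noncomputable section

/-! ### Linear algebra of diagonalizable operators. -/

section Eigenspaces

variable {K V : Type*} [Field K] [AddCommGroup V] [Module K V]

/-- The eigencomponents of an element of an invariant submodule lie in that submodule. -/
theorem Submodule.mem_of_sum_eigenvectors_mem {T : Module.End K V} {W : Submodule K V}
    (hW : ∀ x ∈ W, T x ∈ W) (s : Finset K) (m : K → V) (hm : ∀ μ ∈ s, T (m μ) = μ • m μ)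
    (hs : ∑ μ ∈ s, m μ ∈ W) : ∀ μ ∈ s, m μ ∈ W := by
  classical
  induction s using Finset.induction_on generalizing m with
  | empty => simp
  | insert a s ha ih =>
    have hmem : ∀ μ ∈ s, m μ ∈ W := by
      intro μ hμ
      -- `T - a` kills the `a`-component and rescales the others by nonzero factors.
      have key := ih (fun μ => (μ - a) • m μ)
        (fun ν hν => by
          rw [map_smul, hm ν (Finset.mem_insert_of_mem hν), smul_comm])
        (by
          have := W.sub_mem (hW _ hs) (W.smul_mem a hs)
          rw [map_sum, Finset.smul_sum, ← Finset.sum_sub_distrib, Finset.sum_insert ha,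
            hm a (Finset.mem_insert_self a s), sub_self, zero_add] at this
          convert this using 1
          refine Finset.sum_congr rfl fun ν hν => ?_
          rw [hm ν (Finset.mem_insert_of_mem hν), sub_smul]) μ hμ
      have hne : μ - a ≠ 0 := sub_ne_zero.2 fun h => ha (h ▸ hμ)
      exact (W.smul_mem_iff hne).1 key
    intro μ hμ
    rcases Finset.mem_insert.1 hμ with rfl | h
    · rw [Finset.sum_insert ha] at hs
      exact (W.add_mem_iff_left (W.sum_mem hmem)).1 hs
    · exact hmem μ h

/-- If a space is covered by a submodule `S` of the kernel together with the eigenspaces of positive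
integral eigenvalue, then the kernel meets it in `S`. -/
theorem Module.End.mem_of_mem_sup_iSup_eigenspace [CharZero K] {T : Module.End K V} {S : Submodule K V}
    (hS : ∀ x ∈ S, T x = 0) {x : V} (hx : x ∈ S ⊔ ⨆ r : ℕ, T.eigenspace ((r + 1 : ℕ) : K))
    (hTx : T x = 0) : x ∈ S := by
  obtain ⟨y, hy, z, hz, rfl⟩ := Submodule.mem_sup.1 hx
  have hz0 : z ∈ T.eigenspace 0 := by
    rw [Module.End.mem_eigenspace_iff, zero_smul]
    simpa [hS y hy] using hTx
  have : z = 0 := by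
    have hle : ⨆ r : ℕ, T.eigenspace ((r + 1 : ℕ) : K) ≤ ⨆ μ, ⨆ (_ : μ ≠ 0), T.eigenspace μ :=
      iSup_le fun r => le_iSup₂_of_le ((r + 1 : ℕ) : K) (Nat.cast_ne_zero.2 r.succ_ne_zero) le_rfl
    simpa using (T.eigenspaces_iSupIndep 0).le_bot (⟨hz0, hle hz⟩ : z ∈ T.eigenspace 0 ⊓ _)
  simpa [this] using hy

/-- A homotopy formula: if the Laplacian `T = dh + hd` of a differential is diagonalizable,
a closed element of an invariant submodule is the sum of a harmonic element and the boundary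
of `h g`, both taken in that submodule. -/
theorem exists_harmonic_add_boundary {d h T : Module.End K V} (hT : ∀ x, T x = d (h x) + h (d x))
    (hd : ∀ x, d (d x) = 0) (htop : ⨆ μ, T.eigenspace μ = ⊤) {W : Submodule K V}
    (hW : ∀ x ∈ W, T x ∈ W) {f : V} (hf : f ∈ W) (hdf : d f = 0) :
    ∃ c ∈ W, ∃ g ∈ W, T c = 0 ∧ f = c + d (h g) := by
  classical
  have hfT : f ∈ ⨆ μ, T.eigenspace μ := htop ▸ Submodule.mem_top
  obtain ⟨m, hm, hsum⟩ := (Submodule.mem_iSup_iff_exists_finsupp _ _).1 hfT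
  have hm' : ∀ μ, T (m μ) = μ • m μ := fun μ => Module.End.mem_eigenspace_iff.1 (hm μ)
  -- On `ker d` the operator `T` is `d ∘ h`, whose values are closed, so `W ⊓ ker d` is again
  -- invariant.
  have hmem := Submodule.mem_of_sum_eigenvectors_mem (T := T) (W := W ⊓ LinearMap.ker d)
    (fun x hx => ⟨hW x hx.1, by
      have hx2 : d x = 0 := hx.2
      simp [hT, hd, hx2]⟩) (insert 0 m.support) m (fun μ _ => hm' μ) (by
      have : ∑ μ ∈ insert 0 m.support, m μ = f := by
        rw [← hsum, Finsupp.sum]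
        refine (Finset.sum_subset (Finset.subset_insert _ _) ?_).symm
        simp
      rw [this]
      exact ⟨hf, hdf⟩)
  have hall : ∀ μ, m μ ∈ W ⊓ LinearMap.ker d := by
    intro μ
    by_cases h0 : μ ∈ m.support
    · exact hmem μ (Finset.mem_insert_of_mem h0)
    · rw [Finsupp.notMem_support_iff.1 h0]
      exact zero_mem _
  -- For `μ ≠ 0` a closed eigenvector is `μ⁻¹ d h` of itself. Since `h` need not preserve `W`, it
  -- stays outside the witness.
  refine ⟨m 0, (hall 0).1, ∑ μ ∈ m.support.erase 0, μ⁻¹ • m μ,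
    W.sum_mem fun μ _ => W.smul_mem _ (hall μ).1, by simp [hm'], ?_⟩
  have hpiece : ∀ μ ∈ m.support.erase 0, d (h (μ⁻¹ • m μ)) = m μ := by
    intro μ hμ
    have h0 : μ ≠ 0 := (Finset.mem_erase.1 hμ).1
    have hk : d (m μ) = 0 := (hall μ).2
    have := hm' μ
    rw [hT, hk, map_zero, add_zero] at this
    rw [map_smul, map_smul, this, inv_smul_smul₀ h0]
  rw [map_sum, map_sum, Finset.sum_congr rfl hpiece, ← hsum, Finsupp.sum]
  by_cases h0 : (0 : K) ∈ m.support
  · rw [Finset.add_sum_erase _ _ h0]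
  · rw [Finset.erase_eq_of_notMem h0, Finsupp.notMem_support_iff.1 h0, zero_add]

end Eigenspaces

namespace TwistedForms

attribute [local instance 100] LieRing.ofAssociativeRing

variable {k : Type*} [Field k] {g : Type*} [LieRing g] [LieAlgebra k g] {n : ℕ}

local notation "𝒰" => UniversalEnvelopingAlgebra k g

/-! ### The standard filtration of U(g). -/

section Filtration

variable (k g) in
/-- The standard filtration of the enveloping algebra: sums of products of at most `m` elements
of the Lie algebra. -/
def stdFiltration (m : ℕ) : Submodule k (UniversalEnvelopingAlgebra k g) :=
  (1 ⊔ LinearMap.range (UniversalEnvelopingAlgebra.ι k : g →ₗ⁅k⁆ 𝒰).toLinearMap) ^ m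

theorem stdFiltration_zero : stdFiltration k g 0 = 1 := pow_zero _

theorem stdFiltration_succ (m : ℕ) : stdFiltration k g (m + 1) = stdFiltration k g m ⊔
    LinearMap.range (UniversalEnvelopingAlgebra.ι k : g →ₗ⁅k⁆ 𝒰).toLinearMap *
      stdFiltration k g m := by
  rw [stdFiltration, pow_succ', Submodule.sup_mul, one_mul]
  rfl

theorem one_mem_stdFiltration_zero : (1 : 𝒰) ∈ stdFiltration k g 0 := by
  rw [stdFiltration_zero]
  exact Submodule.one_le.1 le_rfl

theorem mem_stdFiltration_zero {u : 𝒰} :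
    u ∈ stdFiltration k g 0 ↔ ∃ c : k, algebraMap k _ c = u := by
  rw [stdFiltration_zero, Submodule.mem_one]

theorem stdFiltration_le_succ (m : ℕ) : stdFiltration k g m ≤ stdFiltration k g (m + 1) := by
  rw [stdFiltration_succ]
  exact le_sup_left

theorem stdFiltration_mono : Monotone (stdFiltration k g) :=
  monotone_nat_of_le_succ stdFiltration_le_succ

theorem ι_mul_mem_stdFiltration (x : g) {m : ℕ} {u : 𝒰} (hu : u ∈ stdFiltration k g m) :
    UniversalEnvelopingAlgebra.ι k x * u ∈ stdFiltration k g (m + 1) := by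
  rw [stdFiltration_succ]
  exact Submodule.mem_sup_right (Submodule.mul_mem_mul ⟨x, rfl⟩ hu)

/-- To bound `stdFiltration (m + 1)` it is enough to bound the previous step and the products of its
elements with elements of the Lie algebra. -/
theorem stdFiltration_succ_le {m : ℕ} {S : Submodule k 𝒰} (h : stdFiltration k g m ≤ S)
    (hmul : ∀ x : g, ∀ u ∈ stdFiltration k g m, UniversalEnvelopingAlgebra.ι k x * u ∈ S) :
    stdFiltration k g (m + 1) ≤ S := by
  rw [stdFiltration_succ]
  refine sup_le h (Submodule.mul_le.2 ?_)
  rintro _ ⟨x, rfl⟩ u hu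
  exact hmul x u hu

/-- The union is a subalgebra containing the image of `g`; by the universal property the identity of
U(g) factors through it. -/
theorem iSup_stdFiltration : ⨆ m, stdFiltration k g m = ⊤ := by
  have hdir : Directed (· ≤ ·) (stdFiltration k g) := stdFiltration_mono.directed_le
  have hmul : ∀ u v : 𝒰, u ∈ ⨆ m, stdFiltration k g m → v ∈ ⨆ m, stdFiltration k g m →
      u * v ∈ ⨆ m, stdFiltration k g m := by
    intro u v hu hv
    rw [Submodule.mem_iSup_of_directed _ hdir] at hu hv ⊢
    obtain ⟨a, ha⟩ := hu
    obtain ⟨c, hc⟩ := hv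
    refine ⟨a + c, ?_⟩
    rw [stdFiltration, pow_add]
    exact Submodule.mul_mem_mul ha hc
  let S : Subalgebra k 𝒰 := (⨆ m, stdFiltration k g m).toSubalgebra
    (Submodule.mem_iSup_of_mem 0 one_mem_stdFiltration_zero) hmul
  have hι : ∀ x : g, UniversalEnvelopingAlgebra.ι k x ∈ S := fun x =>
    Submodule.mem_iSup_of_mem (p := stdFiltration k g) 1
      (by simpa using ι_mul_mem_stdFiltration x (one_mem_stdFiltration_zero (k := k) (g := g)))
  let F : 𝒰 →ₐ[k] S := UniversalEnvelopingAlgebra.lift k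
    { toFun := fun x => ⟨UniversalEnvelopingAlgebra.ι k x, hι x⟩
      map_add' := fun x y => Subtype.ext (by simp)
      map_smul' := fun c x => Subtype.ext (by simp)
      map_lie' := fun {x y} => Subtype.ext (by
        simp [LieRing.of_associative_ring_bracket]) }
  have hF : S.val.comp F = AlgHom.id k 𝒰 := by
    ext x
    simp [F]
  refine eq_top_iff.2 fun u _ => ?_
  have := congrArg (fun G : 𝒰 →ₐ[k] 𝒰 => G u) hF
  simp only [AlgHom.comp_apply, AlgHom.id_apply] at this
  rw [← this]
  exact (F u).2

variable (k g) in
/-- The standard filtration shifted by one, starting at zero. -/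
def shiftedFiltration : ℕ → Submodule k (UniversalEnvelopingAlgebra k g)
  | 0 => ⊥
  | m + 1 => stdFiltration k g m

theorem shiftedFiltration_le (m : ℕ) : shiftedFiltration k g m ≤ stdFiltration k g m := by
  cases m with
  | zero => exact bot_le
  | succ m => exact stdFiltration_le_succ m

theorem shiftedFiltration_mono : Monotone (shiftedFiltration k g) :=
  monotone_nat_of_le_succ fun m => shiftedFiltration_le m

theorem ι_mul_mem_of_mem_shiftedFiltration (x : g) {m : ℕ} {u : 𝒰}
    (hu : u ∈ shiftedFiltration k g m) :
    UniversalEnvelopingAlgebra.ι k x * u ∈ stdFiltration k g m := by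
  cases m with
  | zero =>
    rw [(Submodule.mem_bot k).1 hu, mul_zero]
    exact zero_mem _
  | succ m => exact ι_mul_mem_stdFiltration x hu

/-- This follows the recursion that characterizes `fock`: the value at `1`, then left multiplication
by elements of `g`. -/
theorem uea_induction {p : 𝒰 → Prop} (one : p 1) (smul : ∀ (c : k) u, p u → p (c • u))
    (add : ∀ u v, p u → p v → p (u + v))
    (ι_mul : ∀ (x : g) u, p u → p (UniversalEnvelopingAlgebra.ι k x * u)) (u : 𝒰) : p u := by
  let S : Submodule k 𝒰 :=
    { carrier := {u | p u}
      add_mem' := fun {a b} ha hb => add a b ha hb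
      zero_mem' := by simpa using smul 0 1 one
      smul_mem' := fun c u hu => smul c u hu }
  have hS : ∀ m, stdFiltration k g m ≤ S := by
    intro m
    induction m with
    | zero =>
      rw [stdFiltration_zero]
      exact Submodule.one_le.2 one
    | succ m ih => exact stdFiltration_succ_le ih fun x u hu => ι_mul x u (ih hu)
  exact (iSup_stdFiltration (k := k) (g := g) ▸ iSup_le hS : ⊤ ≤ S) (Submodule.mem_top (x := u))

end Filtration

/-! ### The counit of U(g). -/

section Counit

variable (k g) in
/-- The counit of the enveloping algebra. -/
def counit : UniversalEnvelopingAlgebra k g →ₐ[k] k :=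
  UniversalEnvelopingAlgebra.lift k (0 : g →ₗ⁅k⁆ k)

theorem counit_ι_mul (x : g) (u : 𝒰) :
    counit k g (UniversalEnvelopingAlgebra.ι k x * u) = 0 := by
  rw [map_mul, counit, UniversalEnvelopingAlgebra.lift_ι_apply]
  simp

end Counit

/-! ### The deformed Fock action and the deformed derivatives. -/

section Fock

variable (φ : g →ₗ⁅k⁆ Derivation k (SHat k n) (SHat k n))

/-- The deformed Fock action is multiplicative. -/
theorem fock_fock (u : 𝒰) (P Q : SHat k n) : fock φ (fock φ u Q) P = fock φ u (P * Q) := by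
  induction u using uea_induction generalizing P Q with
  | one =>
    rw [fock_one, fock_one, Algebra.algebraMap_eq_smul_one, map_smul, LinearMap.smul_apply,
      fock_one, map_mul, mul_comm, map_mul, Algebra.smul_def]
  | smul c u hu => simp [hu]
  | add u v hu hv => simp [hu, hv]
  | ι_mul x u hu =>
    -- The Leibniz rule for `φ (-x)` on `P * Q` accounts for the two correction terms.
    rw [fock_mul, map_add, LinearMap.add_apply, fock_mul, hu, hu, hu, fock_mul,
      Derivation.leibniz, map_add, smul_eq_mul, smul_eq_mul, mul_comm Q]
    abel

theorem fock_one_right (u : 𝒰) : fock φ u 1 = u := by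
  induction u using uea_induction with
  | one => simp [fock_one]
  | smul c u hu => simp [hu]
  | add u v hu hv => simp [hu, hv]
  | ι_mul x u hu => rw [fock_mul, hu, Derivation.map_one_eq_zero, map_zero, add_zero]

theorem fock_mem_stdFiltration {m : ℕ} {u : 𝒰} (hu : u ∈ stdFiltration k g m) (P : SHat k n) :
    fock φ u P ∈ stdFiltration k g m := by
  induction m generalizing u P with
  | zero =>
    obtain ⟨c, rfl⟩ := mem_stdFiltration_zero.1 hu
    rw [Algebra.algebraMap_eq_smul_one, map_smul, LinearMap.smul_apply, fock_one]
    exact Submodule.smul_mem _ _ (mem_stdFiltration_zero.2 ⟨_, rfl⟩)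
  | succ m ih =>
    suffices stdFiltration k g (m + 1) ≤
        (stdFiltration k g (m + 1)).comap ((fock φ).flip P) from this hu
    refine stdFiltration_succ_le (fun v hv => stdFiltration_le_succ m (ih hv P)) ?_
    intro x v hv
    rw [Submodule.mem_comap, LinearMap.flip_apply, fock_mul]
    exact add_mem (ι_mul_mem_stdFiltration x (ih hv P)) (stdFiltration_le_succ m (ih hv _))

/-- A power series without constant term lowers the filtration degree. -/
theorem fock_mem_shiftedFiltration {m : ℕ} {u : 𝒰} (hu : u ∈ stdFiltration k g m) {P : SHat k n}
    (hP : MvPowerSeries.constantCoeff P = 0) : fock φ u P ∈ shiftedFiltration k g m := by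
  induction m generalizing u with
  | zero =>
    obtain ⟨c, rfl⟩ := mem_stdFiltration_zero.1 hu
    rw [Algebra.algebraMap_eq_smul_one, map_smul, LinearMap.smul_apply, fock_one, hP]
    simp
  | succ m ih =>
    suffices stdFiltration k g (m + 1) ≤
        (shiftedFiltration k g (m + 1)).comap ((fock φ).flip P) from this hu
    refine stdFiltration_succ_le (fun v hv => shiftedFiltration_le m (ih hv)) ?_
    intro x v hv
    rw [Submodule.mem_comap, LinearMap.flip_apply, fock_mul]
    -- `φ (-x) P` may have a constant term, so it only preserves step `m`; the shifted step `m + 1`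
    -- asks no more.
    exact add_mem (ι_mul_mem_of_mem_shiftedFiltration x (ih hv)) (fock_mem_stdFiltration φ hv _)

theorem dHatPartial_apply (j : Fin n) (u : 𝒰) :
    dHatPartial φ j u = fock φ u (MvPowerSeries.X j) := rfl

theorem dHatPartial_comm (i j : Fin n) (u : 𝒰) :
    dHatPartial φ i (dHatPartial φ j u) = dHatPartial φ j (dHatPartial φ i u) := by
  simp only [dHatPartial_apply, fock_fock, mul_comm]

theorem dHatPartial_one (j : Fin n) : dHatPartial φ j (1 : 𝒰) = 0 := by
  simp [dHatPartial_apply, fock_one]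

theorem dHatPartial_mem {m : ℕ} {u : 𝒰} (hu : u ∈ stdFiltration k g m) (j : Fin n) :
    dHatPartial φ j u ∈ shiftedFiltration k g m :=
  fock_mem_shiftedFiltration φ hu (by simp)

end Fock

/-! ### Canonical commutation relations and the Euler operator on U(g). -/

section Coordinates

variable (b : Module.Basis (Fin n) k g) (φ : g →ₗ⁅k⁆ Derivation k (SHat k n) (SHat k n))

theorem CloseToIdentity.isUnit_det {b : Module.Basis (Fin n) k g}
    {φ : g →ₗ⁅k⁆ Derivation k (SHat k n) (SHat k n)} (hφ : CloseToIdentity b φ) :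
    IsUnit (phiMatrix b φ).det := by
  rw [MvPowerSeries.isUnit_iff_constantCoeff, RingHom.map_det, RingHom.mapMatrix_apply]
  rw [CloseToIdentity] at hφ
  simp [hφ]

theorem CloseToIdentity.constantCoeff_inv {b : Module.Basis (Fin n) k g}
    {φ : g →ₗ⁅k⁆ Derivation k (SHat k n) (SHat k n)} (hφ : CloseToIdentity b φ) :
    (phiMatrix b φ)⁻¹.map (MvPowerSeries.constantCoeff (σ := Fin n) (R := k)) = 1 := by
  have h := congrArg (fun M => M.map (MvPowerSeries.constantCoeff (σ := Fin n) (R := k)))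
    (Matrix.mul_nonsing_inv _ hφ.isUnit_det)
  rw [CloseToIdentity] at hφ
  simp only [Matrix.map_mul, hφ, one_mul] at h
  rw [h, Matrix.map_one _ (map_zero _) (map_one _)]

/-- The undeformed coordinate operators `x_i = ∑ x̂_l (φ⁻¹)^l_i` on the enveloping algebra. -/
def coordOp (i : Fin n) : Module.End k (UniversalEnvelopingAlgebra k g) :=
  ∑ l : Fin n, LinearMap.mulLeft k (UniversalEnvelopingAlgebra.ι k (b l)) ∘ₗ
    (fock φ).flip ((phiMatrix b φ)⁻¹ l i)

theorem coordOp_apply (i : Fin n) (u : 𝒰) : coordOp b φ i u =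
    ∑ l : Fin n, UniversalEnvelopingAlgebra.ι k (b l) * fock φ u ((phiMatrix b φ)⁻¹ l i) := by
  simp [coordOp]

/-- Every summand starts with a factor from `g`. This excludes nonzero scalars as commutators of
coordinates. -/
theorem counit_coordOp (i : Fin n) (u : 𝒰) : counit k g (coordOp b φ i u) = 0 := by
  rw [coordOp_apply, map_sum]
  exact Finset.sum_eq_zero fun l _ => counit_ι_mul _ _

/-- The Euler operator `∑ x_i ∂̂^i`. -/
def eulerOp : Module.End k (UniversalEnvelopingAlgebra k g) :=
  ∑ i : Fin n, coordOp b φ i ∘ₗ dHatPartial φ i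

theorem eulerOp_apply (u : 𝒰) :
    eulerOp b φ u = ∑ i : Fin n, coordOp b φ i (dHatPartial φ i u) := by
  simp [eulerOp]

theorem eulerOp_algebraMap (c : k) : eulerOp b φ (algebraMap k _ c : 𝒰) = 0 := by
  rw [Algebra.algebraMap_eq_smul_one, map_smul, eulerOp_apply]
  simp [dHatPartial_one]

variable {b φ}

/-- The canonical commutation relations. -/
theorem dHatPartial_coordOp (hφ : CloseToIdentity b φ) (i j : Fin n) (u : 𝒰) :
    dHatPartial φ j (coordOp b φ i u) =
      coordOp b φ i (dHatPartial φ j u) + if j = i then u else 0 := by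
  -- Moving ∂ʲ past x̂_l produces φʲ_l, and ∑ φʲ_l (φ⁻¹)ˡ_i = δʲ_i.
  have hsum : ∑ l : Fin n, fock φ u (φ (-(b l)) (MvPowerSeries.X j) * (phiMatrix b φ)⁻¹ l i) =
      if j = i then u else 0 := by
    rw [← map_sum]
    have : ∑ l : Fin n, φ (-(b l)) (MvPowerSeries.X j) * (phiMatrix b φ)⁻¹ l i =
        (1 : Matrix (Fin n) (Fin n) (SHat k n)) j i := by
      rw [← Matrix.mul_nonsing_inv _ hφ.isUnit_det, Matrix.mul_apply]
      rfl
    rw [this, Matrix.one_apply]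
    split_ifs
    · exact fock_one_right φ u
    · simp
  rw [coordOp_apply, coordOp_apply, map_sum, ← hsum, ← Finset.sum_add_distrib]
  refine Finset.sum_congr rfl fun l _ => ?_
  rw [dHatPartial_apply, dHatPartial_apply, fock_mul, fock_fock, fock_fock, fock_fock, mul_comm]

/-- Inverting the definition gives x̂_l = ∑ x_i φⁱ_l, so the coordinates also build the filtration
up from `1`. -/
theorem sum_coordOp_fock (hφ : CloseToIdentity b φ) (l : Fin n) (u : 𝒰) :
    ∑ i : Fin n, coordOp b φ i (fock φ u (phiMatrix b φ i l)) =
      UniversalEnvelopingAlgebra.ι k (b l) * u := by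
  simp only [coordOp_apply, fock_fock]
  rw [Finset.sum_comm]
  simp only [← Finset.mul_sum, ← map_sum, ← Matrix.mul_apply,
    Matrix.nonsing_inv_mul _ hφ.isUnit_det]
  rw [Finset.sum_eq_single l]
  · rw [Matrix.one_apply_eq, fock_one_right]
  · intro m _ hm
    rw [Matrix.one_apply_ne hm, map_zero, mul_zero]
  · simp

/-- φ⁻¹ - 1 vanishes at ∂ = 0, so its Fock action lowers the filtration by one and multiplication by
x̂_l restores the step. Here φ(0) = 1 matters, beyond the invertibility of φ. -/
theorem coordOp_sub_mem (hφ : CloseToIdentity b φ) (i : Fin n) {m : ℕ} {u : 𝒰}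
    (hu : u ∈ stdFiltration k g m) :
    coordOp b φ i u - UniversalEnvelopingAlgebra.ι k (b i) * u ∈ stdFiltration k g m := by
  have h : coordOp b φ i u - UniversalEnvelopingAlgebra.ι k (b i) * u =
      ∑ l : Fin n, UniversalEnvelopingAlgebra.ι k (b l) * fock φ u ((phiMatrix b φ)⁻¹ l i -
        (1 : Matrix (Fin n) (Fin n) (SHat k n)) l i) := by
    simp only [map_sub, mul_sub, Finset.sum_sub_distrib, ← coordOp_apply]
    congr 1
    rw [Finset.sum_eq_single i]
    · rw [Matrix.one_apply_eq, fock_one_right]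
    · intro m _ hm
      rw [Matrix.one_apply_ne hm, map_zero, mul_zero]
    · simp
  rw [h]
  refine Submodule.sum_mem _ fun l _ => ι_mul_mem_of_mem_shiftedFiltration _
    (fock_mem_shiftedFiltration φ hu ?_)
  have := congrFun (congrFun hφ.constantCoeff_inv l) i
  rw [Matrix.map_apply] at this
  rw [map_sub, this, Matrix.one_apply, Matrix.one_apply]
  split_ifs <;> simp

theorem coordOp_mem (i : Fin n) {m : ℕ} {u : 𝒰} (hu : u ∈ stdFiltration k g m) :
    coordOp b φ i u ∈ stdFiltration k g (m + 1) := by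
  rw [coordOp_apply]
  exact Submodule.sum_mem _ fun l _ =>
    ι_mul_mem_stdFiltration _ (fock_mem_stdFiltration φ hu _)

/-- The commutator of two coordinate operators raises the filtration degree by one only. -/
theorem coordOp_commutator_mem (hφ : CloseToIdentity b φ) (i j : Fin n) {m : ℕ} {u : 𝒰}
    (hu : u ∈ stdFiltration k g m) :
    coordOp b φ i (coordOp b φ j u) - coordOp b φ j (coordOp b φ i u) ∈
      stdFiltration k g (m + 1) := by
  -- Modulo step `m + 1`, x_i x_j u is x̂_i x̂_j u, and [x̂_i, x̂_j] u is a single Lie factor times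
  -- u.
  have aux : ∀ i j : Fin n, coordOp b φ i (coordOp b φ j u) -
      UniversalEnvelopingAlgebra.ι k (b i) * (UniversalEnvelopingAlgebra.ι k (b j) * u) ∈
        stdFiltration k g (m + 1) := by
    intro i j
    have h1 := coordOp_sub_mem hφ i (coordOp_mem (b := b) (φ := φ) j hu)
    have h2 := ι_mul_mem_stdFiltration (b i) (coordOp_sub_mem hφ j hu)
    convert add_mem h1 h2 using 1
    rw [mul_sub]
    abel
  have hlie := ι_mul_mem_stdFiltration ⁅b i, b j⁆ hu
  rw [LieHom.map_lie, LieRing.of_associative_ring_bracket, sub_mul, mul_assoc, mul_assoc] at hlie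
  convert add_mem (sub_mem (aux i j) (aux j i)) hlie using 1
  abel

theorem stdFiltration_succ_le_of_coordOp (hφ : CloseToIdentity b φ) {m : ℕ} {S : Submodule k 𝒰}
    (h : stdFiltration k g m ≤ S)
    (hmul : ∀ i : Fin n, ∀ u ∈ stdFiltration k g m, coordOp b φ i u ∈ S) :
    stdFiltration k g (m + 1) ≤ S := by
  refine stdFiltration_succ_le h fun x u hu => ?_
  rw [← b.sum_repr x, map_sum, Finset.sum_mul]
  refine S.sum_mem fun l _ => ?_
  rw [map_smul, smul_mul_assoc, ← sum_coordOp_fock hφ]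
  exact S.smul_mem _ (S.sum_mem fun i _ => hmul i _ (fock_mem_stdFiltration φ hu _))

/-- This is [E, x_i] = x_i. Commutation is asked only at the vectors ∂̂ʲu, which lie one filtration
step below u; that makes the induction possible. -/
theorem eulerOp_coordOp (hφ : CloseToIdentity b φ) (i : Fin n) (u : 𝒰)
    (hu : ∀ j, coordOp b φ j (coordOp b φ i (dHatPartial φ j u)) =
      coordOp b φ i (coordOp b φ j (dHatPartial φ j u))) :
    eulerOp b φ (coordOp b φ i u) = coordOp b φ i (eulerOp b φ u) + coordOp b φ i u := by
  rw [eulerOp_apply, eulerOp_apply, map_sum]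
  simp only [dHatPartial_coordOp hφ, map_add, hu, Finset.sum_add_distrib]
  congr 1
  rw [Finset.sum_eq_single i] <;> simp +contextual

/-- If the coordinate operators commute on the step before `m`, the Euler operator is diagonalizable
on `stdFiltration (m + 1)`, with the scalars as its kernel. -/
theorem stdFiltration_le_eigenspaces (hφ : CloseToIdentity b φ) {m : ℕ}
    (hm : ∀ u ∈ shiftedFiltration k g m, ∀ i j,
      coordOp b φ i (coordOp b φ j u) = coordOp b φ j (coordOp b φ i u)) :
    stdFiltration k g (m + 1) ≤
      1 ⊔ ⨆ r : ℕ, (eulerOp b φ).eigenspace ((r + 1 : ℕ) : k) := by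
  -- Spanning eigenvectors: each x_i raises the eigenvalue by one, so eigenvalue index `0` occurs
  -- only at the scalars one starts from.
  let S : ℕ → Set 𝒰 := fun l => {u | u ∈ stdFiltration k g l ∧
    ∃ r : ℕ, eulerOp b φ u = (r : k) • u ∧ (r = 0 → u ∈ (1 : Submodule k 𝒰))}
  have hS : ∀ l ≤ m + 1, stdFiltration k g l ≤ Submodule.span k (S l) := by
    intro l
    induction l with
    | zero =>
      intro _
      rw [stdFiltration_zero, Submodule.one_le]
      refine Submodule.subset_span ⟨one_mem_stdFiltration_zero, 0, ?_, fun _ =>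
        Submodule.one_le.1 le_rfl⟩
      simpa using eulerOp_algebraMap b φ 1
    | succ l ih =>
      intro hl
      have ihl := ih (by omega)
      refine stdFiltration_succ_le_of_coordOp hφ
        (ihl.trans (Submodule.span_mono fun u hu => ⟨stdFiltration_le_succ l hu.1, hu.2⟩)) ?_
      intro i
      suffices Submodule.span k (S l) ≤ (Submodule.span k (S (l + 1))).comap (coordOp b φ i) from
        fun u hu => this (ihl hu)
      refine Submodule.span_le.2 ?_
      rintro u ⟨hu, r, hr, -⟩
      refine Submodule.subset_span ⟨coordOp_mem i hu, r + 1, ?_, by simp⟩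
      rw [eulerOp_coordOp hφ i u fun j => hm _ (shiftedFiltration_mono (Nat.le_of_succ_le_succ hl)
        (dHatPartial_mem φ hu j)) j i, hr, map_smul, Nat.cast_succ, add_smul, one_smul]
  refine (hS _ le_rfl).trans (Submodule.span_le.2 ?_)
  rintro u ⟨-, r, hr, h0⟩
  cases r with
  | zero => exact Submodule.mem_sup_left (h0 rfl)
  | succ r =>
    exact Submodule.mem_sup_right
      (Submodule.mem_iSup_of_mem r (Module.End.mem_eigenspace_iff.2 hr))

theorem eulerOp_eq_zero_of_mem_one (u : 𝒰) (hu : u ∈ (1 : Submodule k 𝒰)) :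
    eulerOp b φ u = 0 := by
  obtain ⟨c, rfl⟩ := Submodule.mem_one.1 hu
  exact eulerOp_algebraMap b φ c

/-- Commutation below step `m` diagonalizes the Euler operator on step `m + 1`. The commutator
applied to an element of step `m` lies exactly there, since it gains one step and not two. -/
theorem coordOp_comm_of_mem [CharZero k] (hφ : CloseToIdentity b φ) (m : ℕ) :
    ∀ u ∈ shiftedFiltration k g m, ∀ i j,
      coordOp b φ i (coordOp b φ j u) = coordOp b φ j (coordOp b φ i u) := by
  induction m with
  | zero =>
    intro u hu
    rw [(Submodule.mem_bot k).1 hu]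
    simp
  | succ m ih =>
    intro u hu i j
    rw [← sub_eq_zero]
    set v := coordOp b φ i (coordOp b φ j u) - coordOp b φ j (coordOp b φ i u) with hv
    -- The Kronecker terms cancel, leaving the commutator at ∂̂ˡu, where the induction hypothesis
    -- applies.
    have hD : ∀ l, dHatPartial φ l v = 0 := by
      intro l
      rw [hv, map_sub]
      simp only [dHatPartial_coordOp hφ, map_add]
      rw [ih _ (dHatPartial_mem φ hu l) i j]
      split_ifs <;> (try simp only [map_zero]) <;> abel
    have hE : eulerOp b φ v = 0 := by
      rw [eulerOp_apply]
      simp [hD]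
    have h1 : v ∈ (1 : Submodule k 𝒰) := Module.End.mem_of_mem_sup_iSup_eigenspace
      eulerOp_eq_zero_of_mem_one
      (stdFiltration_le_eigenspaces hφ ih (coordOp_commutator_mem hφ i j hu)) hE
    obtain ⟨c, hc⟩ := Submodule.mem_one.1 h1
    have hε : counit k g v = 0 := by
      rw [hv, map_sub, counit_coordOp, counit_coordOp, sub_zero]
    rw [← hc] at hε ⊢
    rw [AlgHom.commutes] at hε
    have : c = 0 := hε
    rw [this, map_zero]

/-- The Euler operator is diagonalizable, with the scalars as its kernel. -/
theorem eigenspaces_eulerOp [CharZero k] (hφ : CloseToIdentity b φ) :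
    (1 : Submodule k 𝒰) ⊔ ⨆ r : ℕ, (eulerOp b φ).eigenspace ((r + 1 : ℕ) : k) = ⊤ := by
  rw [eq_top_iff, ← iSup_stdFiltration]
  exact iSup_le fun m => (stdFiltration_le_succ m).trans
    (stdFiltration_le_eigenspaces hφ (coordOp_comm_of_mem hφ m))

end Coordinates

/-! ### Contractions and degree in the exterior algebra. -/

section Exterior

theorem contractLeft_mem_exteriorPower (d : Module.Dual k g) {p : ℕ} {ω : ExteriorAlgebra k g}
    (hω : ω ∈ ⋀[k]^(p + 1) g) : CliffordAlgebra.contractLeft d ω ∈ ⋀[k]^p g := by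
  induction p generalizing ω with
  | zero =>
    rw [zero_add, ExteriorAlgebra.exteriorPower, pow_one] at hω
    obtain ⟨x, rfl⟩ := hω
    rw [ExteriorAlgebra.ι, CliffordAlgebra.contractLeft_ι, ExteriorAlgebra.exteriorPower, pow_zero]
    exact Submodule.mem_one.2 ⟨_, rfl⟩
  | succ p ih =>
    suffices ⋀[k]^(p + 1 + 1) g ≤ (⋀[k]^(p + 1) g).comap (CliffordAlgebra.contractLeft d) from
      this hω
    rw [ExteriorAlgebra.exteriorPower, pow_succ', Submodule.mul_le]
    rintro _ ⟨x, rfl⟩ η hη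
    rw [Submodule.mem_comap, ExteriorAlgebra.ι, CliffordAlgebra.contractLeft_ι_mul]
    refine sub_mem (Submodule.smul_mem _ _ hη) ?_
    rw [ExteriorAlgebra.exteriorPower, pow_succ']
    exact Submodule.mul_mem_mul ⟨x, rfl⟩ (ih hη)

theorem contractLeft_of_mem_exteriorPower_zero (d : Module.Dual k g) {ω : ExteriorAlgebra k g}
    (hω : ω ∈ ⋀[k]^0 g) : CliffordAlgebra.contractLeft d ω = 0 := by
  rw [ExteriorAlgebra.exteriorPower, pow_zero] at hω
  obtain ⟨c, rfl⟩ := Submodule.mem_one.1 hω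
  exact CliffordAlgebra.contractLeft_algebraMap (0 : QuadraticForm k g) d c

/-- The degree operator on the exterior algebra. -/
theorem sum_ι_mul_contractLeft (b : Module.Basis (Fin n) k g) {p : ℕ} {ω : ExteriorAlgebra k g}
    (hω : ω ∈ ⋀[k]^p g) :
    ∑ l : Fin n, ExteriorAlgebra.ι k (b l) * CliffordAlgebra.contractLeft (b.coord l) ω =
      (p : k) • ω := by
  induction p generalizing ω with
  | zero => simp [contractLeft_of_mem_exteriorPower_zero _ hω]
  | succ p ih =>
    let N : Module.End k (ExteriorAlgebra k g) := ∑ l : Fin n,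
      LinearMap.mulLeft k (ExteriorAlgebra.ι k (b l)) ∘ₗ CliffordAlgebra.contractLeft (b.coord l)
    have hN : ∀ η, N η = ∑ l : Fin n, ExteriorAlgebra.ι k (b l) *
        CliffordAlgebra.contractLeft (b.coord l) η := fun η => by simp [N]
    suffices ⋀[k]^(p + 1) g ≤ N.eigenspace ((p + 1 : ℕ) : k) by
      rw [← hN]
      exact Module.End.mem_eigenspace_iff.1 (this hω)
    rw [ExteriorAlgebra.exteriorPower, pow_succ', Submodule.mul_le]
    rintro _ ⟨x, rfl⟩ η hη
    rw [Module.End.mem_eigenspace_iff, hN]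
    -- Contraction is an antiderivation and one-forms anticommute, so the two signs cancel and N(xη)
    -- = xη + x N(η).
    have h1 : ∀ l, ExteriorAlgebra.ι k (b l) *
        CliffordAlgebra.contractLeft (b.coord l) (ExteriorAlgebra.ι k x * η) =
        ExteriorAlgebra.ι k (b.coord l x • b l) * η + ExteriorAlgebra.ι k x *
          (ExteriorAlgebra.ι k (b l) * CliffordAlgebra.contractLeft (b.coord l) η) := by
      intro l
      have h2 : ExteriorAlgebra.ι k (b l) * ExteriorAlgebra.ι k x =
          -(ExteriorAlgebra.ι k x * ExteriorAlgebra.ι k (b l)) :=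
        eq_neg_of_add_eq_zero_left (ExteriorAlgebra.ι_add_mul_swap _ _)
      rw [ExteriorAlgebra.ι, CliffordAlgebra.contractLeft_ι_mul] at *
      rw [mul_sub, ← mul_assoc, h2, map_smul, mul_smul_comm, smul_mul_assoc, neg_mul,
        sub_neg_eq_add, mul_assoc]
    rw [Finset.sum_congr rfl fun l _ => h1 l, Finset.sum_add_distrib, ← Finset.sum_mul, ← map_sum,
      ← Finset.mul_sum, ih hη]
    simp only [Module.Basis.coord_apply, b.sum_repr]
    rw [mul_smul_comm, Nat.cast_succ, add_smul, one_smul, add_comm]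

theorem algebraMapInv_of_mem_exteriorPower {p : ℕ} {ω : ExteriorAlgebra k g}
    (hω : ω ∈ ⋀[k]^(p + 1) g) : ExteriorAlgebra.algebraMapInv ω = 0 := by
  suffices ⋀[k]^(p + 1) g ≤
      LinearMap.ker (ExteriorAlgebra.algebraMapInv (R := k) (M := g)).toLinearMap from this hω
  rw [ExteriorAlgebra.exteriorPower, pow_succ', Submodule.mul_le]
  rintro _ ⟨x, rfl⟩ η _
  simp [ExteriorAlgebra.algebraMapInv]

theorem extForms_eq_top_of_homogeneous {S : Submodule k (ExtForms k g n)}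
    (h : ∀ p, ∀ ω ∈ ⋀[k]^p g, ∀ (P : SHat k n) (u : 𝒰), (ω ⊗ₜ[k] P) ⊗ₜ[k] u ∈ S) : S = ⊤ := by
  refine eq_top_iff.2 fun f _ => ?_
  induction f using TensorProduct.induction_on with
  | zero => exact zero_mem _
  | add x y hx hy => exact add_mem (hx trivial) (hy trivial)
  | tmul w u =>
    induction w using TensorProduct.induction_on with
    | zero => simp
    | add x y hx hy =>
      rw [TensorProduct.add_tmul]
      exact add_mem (hx trivial) (hy trivial)
    | tmul ω P =>
      have hω : ω ∈ ⨆ p, ⋀[k]^p g :=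
        (DirectSum.Decomposition.isInternal
          (fun p => ⋀[k]^p g)).submodule_iSup_eq_top ▸ Submodule.mem_top
      induction hω using Submodule.iSup_induction' with
      | mem p ω hω => exact h p ω hω P u
      | zero => simp
      | add x y _ _ hx hy =>
        rw [TensorProduct.add_tmul, TensorProduct.add_tmul]
        exact add_mem (hx trivial) (hy trivial)

end Exterior

/-! ### The frame dx_j and its dual contractions. -/

section Contraction

variable (b : Module.Basis (Fin n) k g) (φ : g →ₗ⁅k⁆ Derivation k (SHat k n) (SHat k n))

theorem dx_mul_tmul (j : Fin n) (ω : ExteriorAlgebra k g) (P : SHat k n) :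
    dx b φ j * (ω ⊗ₜ[k] P) =
      ∑ l : Fin n, (ExteriorAlgebra.ι k (b l) * ω) ⊗ₜ[k] ((phiMatrix b φ)⁻¹ l j * P) := by
  simp [dx, dxHat, ofSHat, Finset.sum_mul]

theorem dx_mul_dx_add_swap (i j : Fin n) :
    dx b φ i * dx b φ j + dx b φ j * dx b φ i = 0 := by
  have h : ∀ i j, dx b φ i * dx b φ j = ∑ l : Fin n, ∑ m : Fin n,
      (ExteriorAlgebra.ι k (b l) * ExteriorAlgebra.ι k (b m)) ⊗ₜ[k]
        ((phiMatrix b φ)⁻¹ l i * (phiMatrix b φ)⁻¹ m j) := by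
    intro i j
    simp [dx, dxHat, ofSHat, Finset.sum_mul, Finset.mul_sum]
    exact Finset.sum_comm
  rw [h, h, Finset.sum_comm, ← Finset.sum_add_distrib]
  refine Finset.sum_eq_zero fun l _ => ?_
  rw [← Finset.sum_add_distrib]
  refine Finset.sum_eq_zero fun m _ => ?_
  rw [mul_comm ((phiMatrix b φ)⁻¹ m i), ← TensorProduct.add_tmul, ExteriorAlgebra.ι_add_mul_swap,
    TensorProduct.zero_tmul]

/-- Contraction with the vector dual to `dx_j`. -/
def contraction (j : Fin n) : Module.End k (FormCoeff k g n) :=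
  ∑ l : Fin n, TensorProduct.map (CliffordAlgebra.contractLeft (b.coord l))
    (LinearMap.mulLeft k (phiMatrix b φ j l))

theorem contraction_tmul (j : Fin n) (ω : ExteriorAlgebra k g) (P : SHat k n) :
    contraction b φ j (ω ⊗ₜ[k] P) =
      ∑ l : Fin n, CliffordAlgebra.contractLeft (b.coord l) ω ⊗ₜ[k] (phiMatrix b φ j l * P) := by
  simp [contraction]

variable {b φ}

/-- An antiderivation is determined by its pairing with one-forms, here ∑ φʲ_l (φ⁻¹)ˡ_i = δʲ_i. -/
theorem contraction_dx_mul (hφ : CloseToIdentity b φ) (i j : Fin n) (w : FormCoeff k g n) :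
    contraction b φ j (dx b φ i * w) =
      (if j = i then w else 0) - dx b φ i * contraction b φ j w := by
  induction w using TensorProduct.induction_on with
  | zero => simp
  | add x y hx hy =>
    rw [mul_add, map_add, hx, hy, map_add, mul_add]
    split_ifs <;> abel
  | tmul ω P =>
    rw [dx_mul_tmul, map_sum, contraction_tmul, Finset.mul_sum]
    simp only [contraction_tmul, dx_mul_tmul]
    have h : ∀ l m : Fin n, CliffordAlgebra.contractLeft (b.coord m)
        (ExteriorAlgebra.ι k (b l) * ω) ⊗ₜ[k] (phiMatrix b φ j m * ((phiMatrix b φ)⁻¹ l i * P)) =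
        (if l = m then ω ⊗ₜ[k] (phiMatrix b φ j l * (phiMatrix b φ)⁻¹ l i * P) else 0) -
        (ExteriorAlgebra.ι k (b l) * CliffordAlgebra.contractLeft (b.coord m) ω) ⊗ₜ[k]
          ((phiMatrix b φ)⁻¹ l i * (phiMatrix b φ j m * P)) := by
      intro l m
      rw [ExteriorAlgebra.ι, CliffordAlgebra.contractLeft_ι_mul, TensorProduct.sub_tmul,
        mul_left_comm]
      congr 1
      rw [Module.Basis.coord_apply, Module.Basis.repr_self, Finsupp.single_apply]
      split_ifs with hlm
      · subst hlm
        rw [one_smul, mul_left_comm, mul_assoc]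
      · simp
    simp only [h, Finset.sum_sub_distrib]
    congr 1
    · simp only [Finset.sum_ite_eq, Finset.mem_univ, if_true]
      rw [← TensorProduct.tmul_sum, ← Finset.sum_mul, ← Matrix.mul_apply,
        Matrix.mul_nonsing_inv _ hφ.isUnit_det, Matrix.one_apply]
      split_ifs <;> simp
    · exact Finset.sum_comm

/-- The factors φ⁻¹φ cancel, leaving the degree operator in the frame dx̂_l. -/
theorem sum_dx_mul_contraction (hφ : CloseToIdentity b φ) {p : ℕ} {ω : ExteriorAlgebra k g}
    (hω : ω ∈ ⋀[k]^p g) (P : SHat k n) :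
    ∑ i : Fin n, dx b φ i * contraction b φ i (ω ⊗ₜ[k] P) = (p : k) • (ω ⊗ₜ[k] P) := by
  simp only [contraction_tmul, Finset.mul_sum, dx_mul_tmul]
  rw [Finset.sum_comm, TensorProduct.smul_tmul', ← sum_ι_mul_contractLeft b hω,
    TensorProduct.sum_tmul]
  refine Finset.sum_congr rfl fun m _ => ?_
  rw [Finset.sum_comm]
  simp only [← TensorProduct.tmul_sum, ← mul_assoc, ← Finset.sum_mul, ← Matrix.mul_apply,
    Matrix.nonsing_inv_mul _ hφ.isUnit_det]
  rw [Finset.sum_eq_single m]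
  · rw [Matrix.one_apply_eq, one_mul]
  · intro l _ hl
    rw [Matrix.one_apply_ne hl, zero_mul, TensorProduct.tmul_zero]
  · simp

/-- The pairings of the contractions with the dx_i are constants, so no power series enter. -/
theorem contraction_mem_adjoin (hφ : CloseToIdentity b φ) (j : Fin n) {w : FormCoeff k g n}
    (hw : w ∈ Algebra.adjoin k (Set.range (dx b φ))) :
    contraction b φ j w ∈ Algebra.adjoin k (Set.range (dx b φ)) := by
  suffices Subalgebra.toSubmodule (Algebra.adjoin k (Set.range (dx b φ))) ≤
      (Subalgebra.toSubmodule (Algebra.adjoin k (Set.range (dx b φ)))).comap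
        (contraction b φ j) from this hw
  rw [Algebra.adjoin_eq_span, Submodule.span_le, ← Algebra.adjoin_eq_span]
  intro w hw
  induction hw using Submonoid.closure_induction_left with
  | one =>
    have : contraction b φ j 1 = 0 := by
      rw [Algebra.TensorProduct.one_def, contraction_tmul]
      simp [CliffordAlgebra.contractLeft_one]
    simp [this]
  | mul_left x hx y hy ih =>
    obtain ⟨i, rfl⟩ := hx
    have hy' : y ∈ Algebra.adjoin k (Set.range (dx b φ)) := by
      rw [← Subalgebra.mem_toSubmodule, Algebra.adjoin_eq_span]
      exact Submodule.subset_span hy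
    simp only [SetLike.mem_coe, Submodule.mem_comap, contraction_dx_mul hφ,
      Subalgebra.mem_toSubmodule] at ih ⊢
    refine sub_mem ?_ (mul_mem (Algebra.subset_adjoin ⟨i, rfl⟩) ih)
    split_ifs
    · exact hy'
    · exact zero_mem _

end Contraction

/-! ### The Laplacian and its spectrum. -/

section Homotopy

variable (b : Module.Basis (Fin n) k g) (φ : g →ₗ⁅k⁆ Derivation k (SHat k n) (SHat k n))

theorem dHat_tmul (w : FormCoeff k g n) (u : 𝒰) :
    dHat b φ (w ⊗ₜ[k] u) = ∑ j : Fin n, (dx b φ j * w) ⊗ₜ[k] dHatPartial φ j u := by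
  simp only [dHat, LinearMap.sum_apply, LinearMap.comp_apply, LinearMap.lTensor_tmul,
    LinearMap.rTensor_tmul, LinearMap.mulLeft_apply]
  rw [Finset.sum_comm]
  refine Finset.sum_congr rfl fun j _ => ?_
  rw [← TensorProduct.sum_tmul, ← Finset.sum_mul, dx]

/-- The dx_i anticommute while the ∂̂ⁱ commute, so twice the square vanishes; then 2 is cancelled.
-/
theorem dHat_dHat [CharZero k] (f : ExtForms k g n) : dHat b φ (dHat b φ f) = 0 := by
  induction f using TensorProduct.induction_on with
  | zero => simp
  | add x y hx hy => rw [map_add, map_add, hx, hy, add_zero]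
  | tmul w u =>
    have h2 : (2 : k) • dHat b φ (dHat b φ (w ⊗ₜ[k] u)) = 0 := by
      rw [two_smul]
      simp only [dHat_tmul, map_sum]
      nth_rewrite 1 [Finset.sum_comm]
      rw [← Finset.sum_add_distrib]
      refine Finset.sum_eq_zero fun i _ => ?_
      rw [← Finset.sum_add_distrib]
      refine Finset.sum_eq_zero fun j _ => ?_
      rw [dHatPartial_comm, ← TensorProduct.add_tmul, ← mul_assoc, ← mul_assoc, ← add_mul,
        dx_mul_dx_add_swap, zero_mul, TensorProduct.zero_tmul]
    exact (smul_eq_zero.1 h2).resolve_left two_ne_zero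

/-- The contracting homotopy `∑ x_j ⊗ ι_j`. -/
def homotopyOp : Module.End k (ExtForms k g n) :=
  ∑ j : Fin n, TensorProduct.map (contraction b φ j) (coordOp b φ j)

theorem homotopyOp_tmul (w : FormCoeff k g n) (u : 𝒰) :
    homotopyOp b φ (w ⊗ₜ[k] u) =
      ∑ j : Fin n, contraction b φ j w ⊗ₜ[k] coordOp b φ j u := by
  simp [homotopyOp]

/-- The Laplacian of the differential and the homotopy. -/
def laplacian : Module.End k (ExtForms k g n) :=
  dHat b φ ∘ₗ homotopyOp b φ + homotopyOp b φ ∘ₗ dHat b φ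

theorem laplacian_apply (f : ExtForms k g n) :
    laplacian b φ f = dHat b φ (homotopyOp b φ f) + homotopyOp b φ (dHat b φ f) := rfl

variable {b φ}

/-- The commutation relations of x_j, ∂̂ⁱ and the anticommutation relations of ι_j, dx_i cancel all
terms with i ≠ j; the diagonal ones add up to the two number operators. -/
theorem laplacian_tmul (hφ : CloseToIdentity b φ) (w : FormCoeff k g n) (u : 𝒰) :
    laplacian b φ (w ⊗ₜ[k] u) =
      (∑ i : Fin n, dx b φ i * contraction b φ i w) ⊗ₜ[k] u + w ⊗ₜ[k] eulerOp b φ u := by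
  have h : ∀ i j : Fin n,
      (dx b φ i * contraction b φ j w) ⊗ₜ[k] dHatPartial φ i (coordOp b φ j u) +
        contraction b φ j (dx b φ i * w) ⊗ₜ[k] coordOp b φ j (dHatPartial φ i u) =
      (if i = j then (dx b φ i * contraction b φ i w) ⊗ₜ[k] u +
        w ⊗ₜ[k] coordOp b φ i (dHatPartial φ i u) else 0) := by
    intro i j
    rw [dHatPartial_coordOp hφ, contraction_dx_mul hφ, TensorProduct.tmul_add,
      TensorProduct.sub_tmul]
    by_cases hij : i = j
    · subst hij
      simp only [if_true]
      abel
    · simp only [hij, Ne.symm hij, if_false, TensorProduct.tmul_zero, TensorProduct.zero_tmul]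
      abel
  rw [laplacian_apply, homotopyOp_tmul, dHat_tmul, map_sum, map_sum]
  simp only [dHat_tmul, homotopyOp_tmul]
  rw [Finset.sum_comm, ← Finset.sum_add_distrib]
  simp only [← Finset.sum_add_distrib, h, Finset.sum_ite_eq, Finset.mem_univ, if_true]
  rw [Finset.sum_add_distrib, TensorProduct.sum_tmul, eulerOp_apply, TensorProduct.tmul_sum]

theorem laplacian_homogeneous (hφ : CloseToIdentity b φ) {p : ℕ} {ω : ExteriorAlgebra k g}
    (hω : ω ∈ ⋀[k]^p g) (P : SHat k n) {u : 𝒰} {μ : k} (hu : eulerOp b φ u = μ • u) :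
    laplacian b φ ((ω ⊗ₜ[k] P) ⊗ₜ[k] u) = ((p : k) + μ) • ((ω ⊗ₜ[k] P) ⊗ₜ[k] u) := by
  rw [laplacian_tmul hφ, sum_dx_mul_contraction hφ hω, hu, TensorProduct.tmul_smul,
    ← TensorProduct.smul_tmul', add_smul]

variable (k g n) in
/-- The subspace `Ŝ(g*)` of the extended algebra. -/
def constForms : Submodule k (ExtForms k g n) :=
  LinearMap.range (((TensorProduct.mk k (FormCoeff k g n) 𝒰).flip 1) ∘ₗ
    (TensorProduct.mk k (ExteriorAlgebra k g) (SHat k n) 1))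

theorem mem_constForms {f : ExtForms k g n} :
    f ∈ constForms k g n ↔ ∃ P : SHat k n, constForm k g P = f := Iff.rfl

theorem laplacian_constForm (hφ : CloseToIdentity b φ) (P : SHat k n) :
    laplacian b φ (constForm k g P) = 0 := by
  have h1 : (1 : ExteriorAlgebra k g) ∈ ⋀[k]^0 g := by
    rw [ExteriorAlgebra.exteriorPower, pow_zero]
    exact Submodule.one_le.1 le_rfl
  have := laplacian_homogeneous hφ h1 P (u := 1) (μ := 0)
    (by simpa using eulerOp_algebraMap b φ 1)
  rw [Nat.cast_zero, add_zero, zero_smul] at this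
  exact this

/-- The Laplacian is diagonalizable, with the constant forms as its kernel. -/
theorem constForms_sup_eigenspaces_laplacian [CharZero k] (hφ : CloseToIdentity b φ) :
    constForms k g n ⊔ ⨆ r : ℕ, (laplacian b φ).eigenspace ((r + 1 : ℕ) : k) = ⊤ := by
  refine extForms_eq_top_of_homogeneous fun p ω hω P u => ?_
  set S := constForms k g n ⊔ ⨆ r : ℕ, (laplacian b φ).eigenspace ((r + 1 : ℕ) : k) with hS
  have heig : ∀ (r : ℕ) (v : 𝒰), laplacian b φ ((ω ⊗ₜ[k] P) ⊗ₜ[k] v) =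
      ((r + 1 : ℕ) : k) • ((ω ⊗ₜ[k] P) ⊗ₜ[k] v) → (ω ⊗ₜ[k] P) ⊗ₜ[k] v ∈ S := fun r v hv =>
    Submodule.mem_sup_right (Submodule.mem_iSup_of_mem r (Module.End.mem_eigenspace_iff.2 hv))
  suffices (1 : Submodule k 𝒰) ⊔ ⨆ r : ℕ, (eulerOp b φ).eigenspace ((r + 1 : ℕ) : k) ≤
      S.comap (TensorProduct.mk k (FormCoeff k g n) 𝒰 (ω ⊗ₜ[k] P)) by
    rw [eigenspaces_eulerOp hφ] at this
    exact this Submodule.mem_top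
  refine sup_le ?_ (iSup_le fun r v hv => ?_)
  · intro v hv
    rw [Submodule.mem_comap, TensorProduct.mk_apply]
    -- Over a scalar of U(g) the eigenvalue is the exterior degree alone: degree zero gives a
    -- constant form, positive degree a positive eigenvalue.
    cases p with
    | zero =>
      rw [ExteriorAlgebra.exteriorPower, pow_zero] at hω
      obtain ⟨a, rfl⟩ := Submodule.mem_one.1 hω
      obtain ⟨c, rfl⟩ := Submodule.mem_one.1 hv
      refine Submodule.mem_sup_left (mem_constForms.2 ⟨c • a • P, ?_⟩)
      simp only [constForm, ofSHat, Algebra.algebraMap_eq_smul_one, TensorProduct.tmul_smul,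
        TensorProduct.smul_tmul']
    | succ p =>
      refine heig p v ?_
      rw [laplacian_homogeneous hφ hω P (μ := 0)
        (by rw [eulerOp_eq_zero_of_mem_one v hv, zero_smul]), add_zero]
  · rw [Submodule.mem_comap, TensorProduct.mk_apply]
    -- The eigenvalue is `p + (r + 1)`, and `heig` is indexed by its predecessor.
    refine heig (p + r) v ?_
    rw [laplacian_homogeneous hφ hω P (Module.End.mem_eigenspace_iff.1 hv), add_assoc p r,
      Nat.cast_add p]

theorem iSup_eigenspace_laplacian [CharZero k] (hφ : CloseToIdentity b φ) :
    ⨆ μ, (laplacian b φ).eigenspace μ = ⊤ := by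
  rw [eq_top_iff, ← constForms_sup_eigenspaces_laplacian hφ]
  refine sup_le ?_ (iSup_le fun r => le_iSup (laplacian b φ).eigenspace ((r + 1 : ℕ) : k))
  rintro _ ⟨P, rfl⟩
  refine Submodule.mem_iSup_of_mem 0 (Module.End.mem_eigenspace_iff.2 ?_)
  rw [zero_smul]
  exact laplacian_constForm hφ P

theorem exists_constForm_of_laplacian_eq_zero [CharZero k] (hφ : CloseToIdentity b φ)
    {f : ExtForms k g n} (hf : laplacian b φ f = 0) : ∃ P : SHat k n, f = constForm k g P := by
  have : f ∈ constForms k g n := by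
    refine Module.End.mem_of_mem_sup_iSup_eigenspace (T := laplacian b φ) ?_ ?_ hf
    · rintro _ ⟨P, rfl⟩
      exact laplacian_constForm hφ P
    · rw [constForms_sup_eigenspaces_laplacian hφ]
      exact Submodule.mem_top
  obtain ⟨P, hP⟩ := mem_constForms.1 this
  exact ⟨P, hP.symm⟩

end Homotopy

/-! ### Stable subspaces and the harmonic forms they contain. -/

section Submodules

variable {b : Module.Basis (Fin n) k g} {φ : g →ₗ⁅k⁆ Derivation k (SHat k n) (SHat k n)}

theorem dHat_mem_uForms {f : ExtForms k g n} (hf : f ∈ uForms b φ) :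
    dHat b φ f ∈ uForms b φ := by
  suffices uForms b φ ≤ (uForms b φ).comap (dHat b φ) from this hf
  refine Submodule.span_le.2 ?_
  rintro _ ⟨ω, hω, u, rfl⟩
  simp only [SetLike.mem_coe, Submodule.mem_comap, dHat_tmul]
  exact Submodule.sum_mem _ fun j _ => Submodule.subset_span
    ⟨_, mul_mem (Algebra.subset_adjoin ⟨j, rfl⟩) hω, _, rfl⟩

theorem homotopyOp_mem_uForms (hφ : CloseToIdentity b φ) {f : ExtForms k g n}
    (hf : f ∈ uForms b φ) : homotopyOp b φ f ∈ uForms b φ := by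
  suffices uForms b φ ≤ (uForms b φ).comap (homotopyOp b φ) from this hf
  refine Submodule.span_le.2 ?_
  rintro _ ⟨ω, hω, u, rfl⟩
  simp only [SetLike.mem_coe, Submodule.mem_comap, homotopyOp_tmul]
  exact Submodule.sum_mem _ fun j _ => Submodule.subset_span
    ⟨_, contraction_mem_adjoin hφ j hω, _, rfl⟩

theorem dHat_mem_formsOfDegree {p : ℕ} {f : ExtForms k g n} (hf : f ∈ formsOfDegree k g n p) :
    dHat b φ f ∈ formsOfDegree k g n (p + 1) := by
  suffices formsOfDegree k g n p ≤ (formsOfDegree k g n (p + 1)).comap (dHat b φ) from this hf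
  refine Submodule.span_le.2 ?_
  rintro _ ⟨ω, hω, P, u, rfl⟩
  simp only [SetLike.mem_coe, Submodule.mem_comap, dHat_tmul, dx_mul_tmul, TensorProduct.sum_tmul]
  refine Submodule.sum_mem _ fun j _ => Submodule.sum_mem _ fun l _ => Submodule.subset_span
    ⟨_, ?_, _, _, rfl⟩
  rw [ExteriorAlgebra.exteriorPower, pow_succ']
  exact Submodule.mul_mem_mul ⟨_, rfl⟩ hω

theorem homotopyOp_mem_formsOfDegree {p : ℕ} {f : ExtForms k g n}
    (hf : f ∈ formsOfDegree k g n (p + 1)) : homotopyOp b φ f ∈ formsOfDegree k g n p := by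
  suffices formsOfDegree k g n (p + 1) ≤ (formsOfDegree k g n p).comap (homotopyOp b φ) from
    this hf
  refine Submodule.span_le.2 ?_
  rintro _ ⟨ω, hω, P, u, rfl⟩
  simp only [SetLike.mem_coe, Submodule.mem_comap, homotopyOp_tmul, contraction_tmul,
    TensorProduct.sum_tmul]
  exact Submodule.sum_mem _ fun j _ => Submodule.sum_mem _ fun l _ => Submodule.subset_span
    ⟨_, contractLeft_mem_exteriorPower _ hω, _, _, rfl⟩

theorem homotopyOp_of_mem_formsOfDegree_zero {f : ExtForms k g n}
    (hf : f ∈ formsOfDegree k g n 0) : homotopyOp b φ f = 0 := by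
  suffices formsOfDegree k g n 0 ≤ LinearMap.ker (homotopyOp b φ) from this hf
  refine Submodule.span_le.2 ?_
  rintro _ ⟨ω, hω, P, u, rfl⟩
  simp [homotopyOp_tmul, contraction_tmul, contractLeft_of_mem_exteriorPower_zero _ hω]

theorem laplacian_mem_uForms (hφ : CloseToIdentity b φ) {f : ExtForms k g n}
    (hf : f ∈ uForms b φ) : laplacian b φ f ∈ uForms b φ :=
  add_mem (dHat_mem_uForms (homotopyOp_mem_uForms hφ hf))
    (homotopyOp_mem_uForms hφ (dHat_mem_uForms hf))

theorem laplacian_mem_formsOfDegree_succ {p : ℕ} {f : ExtForms k g n}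
    (hf : f ∈ formsOfDegree k g n (p + 1)) : laplacian b φ f ∈ formsOfDegree k g n (p + 1) :=
  add_mem (dHat_mem_formsOfDegree (homotopyOp_mem_formsOfDegree hf))
    (homotopyOp_mem_formsOfDegree (dHat_mem_formsOfDegree hf))

variable (k g n) in
/-- The augmentation `Λ*(g) ⊗ Ŝ(g*) → Ŝ(g*)` killing the forms of positive degree. -/
def coeffAugmentation : FormCoeff k g n →ₐ[k] SHat k n :=
  Algebra.TensorProduct.lift ((Algebra.ofId k (SHat k n)).comp ExteriorAlgebra.algebraMapInv)
    (AlgHom.id k (SHat k n)) fun _ _ => Commute.all _ _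

theorem coeffAugmentation_tmul (ω : ExteriorAlgebra k g) (P : SHat k n) :
    coeffAugmentation k g n (ω ⊗ₜ[k] P) = ExteriorAlgebra.algebraMapInv ω • P := by
  simp [coeffAugmentation, Algebra.ofId_apply, Algebra.smul_def]

variable (k g n) in
/-- The augmentation of the extended algebra, by the counit on the enveloping algebra. -/
def augmentation : ExtForms k g n →ₗ[k] SHat k n :=
  (TensorProduct.rid k (SHat k n)).toLinearMap ∘ₗ
    TensorProduct.map (coeffAugmentation k g n).toLinearMap (counit k g).toLinearMap

theorem augmentation_tmul (w : FormCoeff k g n) (u : 𝒰) :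
    augmentation k g n (w ⊗ₜ[k] u) = counit k g u • coeffAugmentation k g n w := by
  simp [augmentation]

/-- The series of a harmonic form is recovered by a linear map, so constraints on the form become
constraints on the series. -/
theorem augmentation_constForm (P : SHat k n) :
    augmentation k g n (constForm k g P) = P := by
  rw [constForm, augmentation_tmul, ofSHat, coeffAugmentation_tmul]
  simp

theorem augmentation_of_mem_formsOfDegree_succ {p : ℕ} {f : ExtForms k g n}
    (hf : f ∈ formsOfDegree k g n (p + 1)) : augmentation k g n f = 0 := by
  suffices formsOfDegree k g n (p + 1) ≤ LinearMap.ker (augmentation k g n) from this hf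
  refine Submodule.span_le.2 ?_
  rintro _ ⟨ω, hω, P, u, rfl⟩
  simp [augmentation_tmul, coeffAugmentation_tmul, algebraMapInv_of_mem_exteriorPower hω]

/-- Each dx_j has positive degree and augments to zero, so the algebra they generate augments to
scalars although its elements involve power series. -/
theorem exists_augmentation_eq_C_of_mem_uForms {f : ExtForms k g n} (hf : f ∈ uForms b φ) :
    ∃ c : k, augmentation k g n f = MvPowerSeries.C c := by
  have hdx : Algebra.adjoin k (Set.range (dx b φ)) ≤ (⊥ : Subalgebra k (SHat k n)).comap
      (coeffAugmentation k g n) := by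
    refine Algebra.adjoin_le ?_
    rintro _ ⟨j, rfl⟩
    have : coeffAugmentation k g n (dx b φ j) = 0 := by
      rw [dx, map_sum]
      refine Finset.sum_eq_zero fun l _ => ?_
      rw [map_mul, dxHat, coeffAugmentation_tmul]
      simp [ExteriorAlgebra.algebraMapInv]
    rw [SetLike.mem_coe, Subalgebra.mem_comap, this]
    exact zero_mem _
  suffices h : uForms b φ ≤ (Subalgebra.toSubmodule (⊥ : Subalgebra k (SHat k n))).comap
      (augmentation k g n) by
    obtain ⟨c, hc⟩ := Algebra.mem_bot.1 (h hf)
    exact ⟨c, hc.symm⟩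
  refine Submodule.span_le.2 ?_
  rintro _ ⟨ω, hω, u, rfl⟩
  rw [SetLike.mem_coe, Submodule.mem_comap, augmentation_tmul]
  exact Submodule.smul_mem _ _ (hdx hω)

theorem exists_constForm_C_of_mem_uForms [CharZero k] (hφ : CloseToIdentity b φ)
    {f : ExtForms k g n} (hf : f ∈ uForms b φ) (hL : laplacian b φ f = 0) :
    ∃ c : k, f = constForm k g (MvPowerSeries.C c) := by
  obtain ⟨P, rfl⟩ := exists_constForm_of_laplacian_eq_zero hφ hL
  obtain ⟨c, hc⟩ := exists_augmentation_eq_C_of_mem_uForms hf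
  rw [augmentation_constForm] at hc
  exact ⟨c, by rw [hc]⟩

theorem eq_zero_of_mem_formsOfDegree_succ [CharZero k] (hφ : CloseToIdentity b φ)
    {p : ℕ} {f : ExtForms k g n} (hf : f ∈ formsOfDegree k g n (p + 1))
    (hL : laplacian b φ f = 0) : f = 0 := by
  obtain ⟨P, rfl⟩ := exists_constForm_of_laplacian_eq_zero hφ hL
  have hP := augmentation_of_mem_formsOfDegree_succ hf
  rw [augmentation_constForm] at hP
  simp [hP, constForm, ofSHat]

/-- No contraction survives in degree zero, so closed forms are harmonic and no boundary term is
needed. -/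
theorem laplacian_eq_zero_of_closed {f : ExtForms k g n} (hf : f ∈ formsOfDegree k g n 0)
    (hd : dHat b φ f = 0) : laplacian b φ f = 0 := by
  rw [laplacian_apply, hd, homotopyOp_of_mem_formsOfDegree_zero hf, map_zero, map_zero, add_zero]

end Submodules

end TwistedForms

end

theorem corollary3p7 {k : Type*} [Field k] [CharZero k] {g : Type*} [LieRing g] [LieAlgebra k g]
    {n : ℕ} (b : Module.Basis (Fin n) k g)
    (φ : g →ₗ⁅k⁆ Derivation k (TwistedForms.SHat k n) (TwistedForms.SHat k n))
    (hφ : TwistedForms.CloseToIdentity b φ) :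
    -- closed `U`-twisted forms, of mixed degree, of degree zero, and of positive degree
    (∀ f ∈ TwistedForms.uForms b φ, TwistedForms.dHat b φ f = 0 →
      ∃ c : k, ∃ h ∈ TwistedForms.uForms b φ,
        f = TwistedForms.constForm k g (MvPowerSeries.C c) + TwistedForms.dHat b φ h) ∧
    (∀ f ∈ TwistedForms.uForms b φ ⊓ TwistedForms.formsOfDegree k g n 0,
      TwistedForms.dHat b φ f = 0 →
        ∃ c : k, f = TwistedForms.constForm k g (MvPowerSeries.C c)) ∧
    (∀ p : ℕ, ∀ f ∈ TwistedForms.uForms b φ ⊓ TwistedForms.formsOfDegree k g n (p + 1),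
      TwistedForms.dHat b φ f = 0 →
        ∃ h ∈ TwistedForms.uForms b φ ⊓ TwistedForms.formsOfDegree k g n p,
          f = TwistedForms.dHat b φ h) ∧
    -- the same for the extended algebra, with constants in `Ŝ(g*)`
    (∀ f : TwistedForms.ExtForms k g n, TwistedForms.dHat b φ f = 0 →
      ∃ P : TwistedForms.SHat k n, ∃ h : TwistedForms.ExtForms k g n,
        f = TwistedForms.constForm k g P + TwistedForms.dHat b φ h) ∧
    (∀ f ∈ TwistedForms.formsOfDegree k g n 0, TwistedForms.dHat b φ f = 0 →
      ∃ P : TwistedForms.SHat k n, f = TwistedForms.constForm k g P) ∧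
    (∀ p : ℕ, ∀ f ∈ TwistedForms.formsOfDegree k g n (p + 1), TwistedForms.dHat b φ f = 0 →
      ∃ h ∈ TwistedForms.formsOfDegree k g n p, f = TwistedForms.dHat b φ h) := by
  -- Only the Laplacian must preserve `W`, so `W` may consist of forms of one degree while the
  -- primitive has degree one less.
  have key : ∀ {W : Submodule k (TwistedForms.ExtForms k g n)},
      (∀ f ∈ W, TwistedForms.laplacian b φ f ∈ W) → ∀ {f}, f ∈ W → TwistedForms.dHat b φ f = 0 →
      ∃ c ∈ W, ∃ h ∈ W, TwistedForms.laplacian b φ c = 0 ∧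
        f = c + TwistedForms.dHat b φ (TwistedForms.homotopyOp b φ h) := fun hW _ hf hd =>
    exists_harmonic_add_boundary (TwistedForms.laplacian_apply b φ)
      (TwistedForms.dHat_dHat b φ) (TwistedForms.iSup_eigenspace_laplacian hφ) hW hf hd
  refine ⟨fun f hf hd => ?_, fun f hf hd => ?_, fun p f hf hd => ?_, fun f hd => ?_,
    fun f hf hd => ?_, fun p f hf hd => ?_⟩
  · obtain ⟨c, hc, h, hh, hL, rfl⟩ := key (fun _ => TwistedForms.laplacian_mem_uForms hφ) hf hd
    obtain ⟨a, rfl⟩ := TwistedForms.exists_constForm_C_of_mem_uForms hφ hc hL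
    exact ⟨a, _, TwistedForms.homotopyOp_mem_uForms hφ hh, rfl⟩
  · exact TwistedForms.exists_constForm_C_of_mem_uForms hφ hf.1
      (TwistedForms.laplacian_eq_zero_of_closed hf.2 hd)
  · obtain ⟨c, hc, h, hh, hL, rfl⟩ := key (W := TwistedForms.uForms b φ ⊓
      TwistedForms.formsOfDegree k g n (p + 1)) (fun _ h =>
        ⟨TwistedForms.laplacian_mem_uForms hφ h.1,
          TwistedForms.laplacian_mem_formsOfDegree_succ h.2⟩) hf hd
    -- Harmonic forms have degree zero, so the harmonic part vanishes in positive degree.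
    rw [TwistedForms.eq_zero_of_mem_formsOfDegree_succ hφ hc.2 hL, zero_add]
    exact ⟨_, ⟨TwistedForms.homotopyOp_mem_uForms hφ hh.1,
      TwistedForms.homotopyOp_mem_formsOfDegree hh.2⟩, rfl⟩
  · obtain ⟨c, -, h, -, hL, rfl⟩ := key (W := ⊤) (fun _ _ => Submodule.mem_top)
      (Submodule.mem_top (x := f)) hd
    obtain ⟨P, rfl⟩ := TwistedForms.exists_constForm_of_laplacian_eq_zero hφ hL
    exact ⟨P, _, rfl⟩
  · exact TwistedForms.exists_constForm_of_laplacian_eq_zero hφ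
      (TwistedForms.laplacian_eq_zero_of_closed hf hd)
  · obtain ⟨c, hc, h, hh, hL, rfl⟩ := key
      (fun _ => TwistedForms.laplacian_mem_formsOfDegree_succ) hf hd
    rw [TwistedForms.eq_zero_of_mem_formsOfDegree_succ hφ hc hL, zero_add]
    exact ⟨_, TwistedForms.homotopyOp_mem_formsOfDegree hh, rfl⟩
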